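/- Theorem 4.1. Let $\mathbb{K}=\mathbb{R}$ or $\mathbb{C}$, let $n\ge 1$, let $G$ be an abelian subgroup of $GL(n,\mathbb{K})$, and for $1\le i\le n$ let $E_i=\{x=(x_1,\dots,x_n)\in\mathbb{K}^n : x_i=0\}$. Then there exist $P\in GL(n,\mathbb{K})$, an integer $r\ge 1$ and linear subspaces $H_1,\dots,H_r$ of $\mathbb{K}^n$ that are $G$-invariant (that is, $A(H_k)\subseteq H_k$ for every $A\in G$) such that: (i) if $\mathbb{K}=\mathbb{C}$, then for every $k$ there is $i_k\in\{1,\dots,n\}$ with $H_k=P(E_{i_k})$; if $\mathbb{K}=\mathbb{R}$, then for every $k$ either $H_k=P(E_{i_k})$ for some $i_k\in\{1,\dots,n\}$, or $H_k=P(E_{i_k}\cap E_{i_k+1})$ for some $i_k\in\{1,\dots,n-1\}$; (ii) if $u,v\in U=\mathbb{K}^n\setminus\bigcup_{k=1}^r H_k$ and $(B_m)_{m\in\mathbb{N}}$ is a sequence in $G$ with $\lim_{m\to\infty}B_m u=v$, then $\lim_{m\to\infty}B_m^{-1}v=u$. -/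

import Mathlib

open Filter Topology

/-- The coordinate hyperplane `E_i = {x ∈ 𝕜ⁿ : x_i = 0}`. -/
def coordHyperplane (𝕜 : Type*) [Field 𝕜] {n : ℕ} (i : Fin n) : Submodule 𝕜 (Fin n → 𝕜) :=
  LinearMap.ker (LinearMap.proj i : (Fin n → 𝕜) →ₗ[𝕜] 𝕜)

/-- The image `P(E)` of a subspace `E` of `𝕜ⁿ` under an invertible matrix `P`. -/
def imageSubspace {𝕜 : Type*} [Field 𝕜] {n : ℕ} (P : GL (Fin n) 𝕜)
    (E : Submodule 𝕜 (Fin n → 𝕜)) : Submodule 𝕜 (Fin n → 𝕜) :=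
  E.map (Matrix.mulVecLin (P : Matrix (Fin n) (Fin n) 𝕜))

/-- A subspace `H` is `G`-invariant if `A(H) ⊆ H` for every `A ∈ G`. -/
def IsInvariantSubspace {𝕜 : Type*} [Field 𝕜] {n : ℕ} (G : Subgroup (GL (Fin n) 𝕜))
    (H : Submodule 𝕜 (Fin n → 𝕜)) : Prop :=
  ∀ A ∈ G, ∀ x ∈ H, Matrix.mulVec (A : Matrix (Fin n) (Fin n) 𝕜) x ∈ H

/-- Property `𝒫` of `G` on a subset `U` of `𝕜ⁿ`: whenever `u, v ∈ U` and `(B_m)` is a sequence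
in `G` with `B_m u → v`, then `B_m⁻¹ v → u`. -/
def PropertyP {𝕜 : Type*} [Field 𝕜] [TopologicalSpace 𝕜] {n : ℕ} (G : Subgroup (GL (Fin n) 𝕜))
    (U : Set (Fin n → 𝕜)) : Prop :=
  ∀ u ∈ U, ∀ v ∈ U, ∀ B : ℕ → GL (Fin n) 𝕜, (∀ m, B m ∈ G) →
    Tendsto (fun m => Matrix.mulVec (B m : Matrix (Fin n) (Fin n) 𝕜) u) atTop (𝓝 v) →
    Tendsto (fun m => Matrix.mulVec (((B m)⁻¹ : GL (Fin n) 𝕜) : Matrix (Fin n) (Fin n) 𝕜) v)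
      atTop (𝓝 u)

/-! Let `A` be the commutative matrix algebra generated by `G`, acting faithfully on `V = Kⁿ`. For
each maximal ideal `I`, Nakayama gives `IV ≠ V`, so `IV` lies in a maximal submodule `H_I`, and
`V/H_I ≅ A/I` is a finite extension of `K`: of degree 1 over `ℂ`, 1 or 2 over `ℝ`. By the Chinese
remainder theorem the `H_I` are in general position, hence given by disjoint blocks of coordinates
in one basis. If `M ∈ A` sends `u` to `v ∈ U`, then `M` is a unit, since otherwise `M ∈ I` for some
`I` and `v ∈ H_I`. A linear section of `M ↦ Mu` replaces `B_m` by a convergent sequence `C_m` in `A`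
with `C_m u = B_m u`; commutativity gives `B_m⁻¹v = C_m⁻¹v`, which tends to `u`
(`tendsto_inv_mulVec`). -/

section ModuleTheory

variable {K A V : Type*} [Field K] [CommRing A] [Algebra K A]
  [AddCommGroup V] [Module K V] [Module A V] [IsScalarTower K A V]

/-- Over a finitely generated faithful module, every maximal ideal `I` admits a maximal submodule
containing `I • ⊤`. -/
theorem exists_isCoatom_smul_le [Module.Finite A V] [FaithfulSMul A V] (I : Ideal A)
    (hI : I.IsMaximal) :
    ∃ H : Submodule A V, IsCoatom H ∧ ∀ a ∈ I, ∀ x : V, a • x ∈ H := by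
  rcases eq_top_or_exists_le_coatom (I • (⊤ : Submodule A V)) with h | ⟨H, hH, hle⟩
  · obtain ⟨a, ha, hav⟩ := Submodule.exists_sub_one_mem_and_smul_eq_zero_of_fg_of_le_smul I
      (⊤ : Submodule A V) Module.Finite.fg_top h.ge
    have ha0 : a = 0 := FaithfulSMul.eq_of_smul_eq_smul (α := V) fun x => by
      rw [hav x trivial, zero_smul]
    rw [ha0, zero_sub, neg_mem_iff] at ha
    exact absurd ((Ideal.eq_top_iff_one I).2 ha) hI.ne_top
  · exact ⟨H, hH, fun a ha x => hle (Submodule.smul_mem_smul ha trivial)⟩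

/-- If the maximal submodule `H` contains `I • ⊤` with `I` maximal, then `V ⧸ H` and `A ⧸ I` have
the same dimension. -/
theorem finrank_quotient_eq_of_isCoatom (I : Ideal A) (hI : I.IsMaximal) (H : Submodule A V)
    (hH : IsCoatom H) (hIH : ∀ a ∈ I, ∀ x : V, a • x ∈ H) :
    Module.finrank K (V ⧸ H.restrictScalars K) = Module.finrank K (A ⧸ I) := by
  have : IsSimpleModule A (V ⧸ H) := isSimpleModule_iff_isCoatom.2 hH
  have := IsSimpleModule.nontrivial A (V ⧸ H)
  obtain ⟨y, hy⟩ := exists_ne (0 : V ⧸ H)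
  have hsurj := IsSimpleModule.toSpanSingleton_surjective A hy
  have hker : LinearMap.ker (LinearMap.toSpanSingleton A (V ⧸ H) y) = I := by
    refine (hI.eq_of_le ?_ ?_).symm
    · intro h
      apply hy
      have : (1 : A) ∈ LinearMap.ker (LinearMap.toSpanSingleton A (V ⧸ H) y) := by
        rw [h]; trivial
      simpa using this
    · intro a ha
      obtain ⟨x, rfl⟩ := Submodule.Quotient.mk_surjective H y
      rw [LinearMap.mem_ker, LinearMap.toSpanSingleton_apply, ← Submodule.Quotient.mk_smul,
        Submodule.Quotient.mk_eq_zero]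
      exact hIH a ha x
  have e := (LinearMap.quotKerEquivOfSurjective _ hsurj)
  rw [hker] at e
  exact ((e.restrictScalars K).symm).finrank_eq

/-- A nonzero finite-dimensional faithful module `V` over a finite-dimensional commutative algebra
has finitely many submodules with field-like quotients, in general position, such that every
non-unit maps `V` into one of them. -/
theorem exists_submodules_of_faithful [FiniteDimensional K A] [FiniteDimensional K V]
    [FaithfulSMul A V] [Nontrivial A]
    (p : ℕ → Prop)
    (hp : ∀ I : Ideal A, I.IsMaximal → p (Module.finrank K (A ⧸ I))) :
    ∃ (r : ℕ) (H : Fin r → Submodule A V), 1 ≤ r ∧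
      (∀ k, p (Module.finrank K (V ⧸ (H k).restrictScalars K))) ∧
      (∀ y : Fin r → V, ∃ x : V, ∀ k, x - y k ∈ H k) ∧
      ∀ a : A, ¬ IsUnit a → ∃ k, ∀ x : V, a • x ∈ H k := by
  have : Module.Finite A V := Module.Finite.of_restrictScalars_finite K A V
  have : IsArtinianRing A := IsArtinianRing.of_finite K A
  obtain ⟨r, ⟨e⟩⟩ := Finite.exists_equiv_fin (MaximalSpectrum A)
  choose H hH hIH using fun I : MaximalSpectrum A =>
    exists_isCoatom_smul_le (V := V) I.asIdeal I.isMaximal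
  refine ⟨r, fun k => H (e.symm k), ?_, ?_, ?_, ?_⟩
  · obtain ⟨I, hI⟩ := Ideal.exists_maximal A
    exact Fin.pos (e ⟨I, hI⟩)
  · intro k
    rw [finrank_quotient_eq_of_isCoatom _ (e.symm k).isMaximal _ (hH _) (hIH _)]
    exact hp _ (e.symm k).isMaximal
  · intro y
    have hcop : Pairwise fun i j => IsCoprime (e.symm i).asIdeal (e.symm j).asIdeal := by
      intro i j hij
      rw [Ideal.isCoprime_iff_sup_eq]
      refine (e.symm i).isMaximal.coprime_of_ne (e.symm j).isMaximal fun h => hij ?_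
      exact e.symm.injective (MaximalSpectrum.ext h)
    -- Chinese remainder theorem: `c i` is 1 modulo the `i`-th ideal and 0 modulo the others.
    choose c hc using fun i : Fin r =>
      Ideal.exists_forall_sub_mem_ideal (I := fun i => (e.symm i).asIdeal)
        (fun _ _ hab => hcop hab) (fun j => if j = i then (1 : A) else 0)
    refine ⟨∑ i, c i • y i, fun k => ?_⟩
    have : ∑ i, c i • y i - y k = ∑ i, (c i - if k = i then (1 : A) else 0) • y i := by
      simp [sub_smul, ite_smul]
    rw [this]
    exact Submodule.sum_mem _ fun i _ => hIH _ _ (hc i k) _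
  · intro a ha
    obtain ⟨I, hI, haI⟩ := exists_max_ideal_of_mem_nonunits ha
    refine ⟨e ⟨I, hI⟩, fun x => ?_⟩
    simp only [e.symm_apply_apply]
    exact hIH ⟨I, hI⟩ a haI x

/-- The version of `exists_submodules_of_faithful` for a faithful representation. -/
theorem exists_submodules_of_injective {K A V : Type*} [Field K] [CommRing A] [Algebra K A]
    [FiniteDimensional K A] [Nontrivial A] [AddCommGroup V] [Module K V] [FiniteDimensional K V]
    (ρ : A →ₐ[K] Module.End K V) (hρ : Function.Injective ρ) (p : ℕ → Prop)
    (hp : ∀ I : Ideal A, I.IsMaximal → p (Module.finrank K (A ⧸ I))) :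
    ∃ (r : ℕ) (H : Fin r → Submodule K V), 1 ≤ r ∧
      (∀ k a, ∀ x ∈ H k, ρ a x ∈ H k) ∧
      (∀ k, p (Module.finrank K (V ⧸ H k))) ∧
      (∀ y : Fin r → V, ∃ x : V, ∀ k, x - y k ∈ H k) ∧
      ∀ a : A, ¬ IsUnit a → ∃ k, ∀ x : V, ρ a x ∈ H k := by
  let : Module A V := Module.compHom V ρ.toRingHom
  have hsmul : ∀ (a : A) (x : V), a • x = ρ a x := fun _ _ => rfl
  have : IsScalarTower K A V := ⟨fun c a x => by
    rw [hsmul, hsmul, map_smul, LinearMap.smul_apply]⟩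
  have : FaithfulSMul A V := ⟨fun {_ _} h => hρ (LinearMap.ext h)⟩
  obtain ⟨r, H, hr, hdim, hgen, hunit⟩ := exists_submodules_of_faithful (V := V) p hp
  exact ⟨r, fun k => (H k).restrictScalars K, hr, fun k a x hx => (H k).smul_mem a hx, hdim,
    hgen, hunit⟩

end ModuleTheory

/-! ### Adapted coordinates -/

section Coordinates

variable {K : Type*} [Field K]

/-- A surjection onto `Kˢ` consists of the first `s` coordinates of some isomorphism with `Kⁿ`. -/
theorem exists_linearEquiv_extending_coordinates {V : Type*} [AddCommGroup V] [Module K V]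
    [FiniteDimensional K V] {n s : ℕ} (hn : Module.finrank K V = n) (F : V →ₗ[K] (Fin s → K))
    (hF : Function.Surjective F) :
    ∃ (hs : s ≤ n) (Q : V ≃ₗ[K] (Fin n → K)), ∀ x i, Q x (Fin.castLE hs i) = F x i := by
  have hdim := F.finrank_range_add_finrank_ker
  rw [LinearMap.range_eq_top.2 hF, finrank_top, Module.finrank_fin_fun, hn] at hdim
  obtain ⟨g, hg⟩ := (LinearMap.ker F).subtype.exists_leftInverse_of_injective (by simp)
  let b := Module.finBasis K (LinearMap.ker F)
  set t := Module.finrank K (LinearMap.ker F) with ht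
  subst hdim
  let R : V →ₗ[K] (Fin s → K) × (Fin t → K) := F.prod (b.equivFun.toLinearMap ∘ₗ g)
  have hR : Function.Injective R := by
    rw [← LinearMap.ker_eq_bot, LinearMap.ker_eq_bot']
    intro x hx
    have h1 : F x = 0 := congrArg Prod.fst hx
    have h2 : b.equivFun (g x) = 0 := congrArg Prod.snd hx
    have h3 : g x = ⟨x, h1⟩ := LinearMap.congr_fun hg ⟨x, h1⟩
    rw [LinearEquiv.map_eq_zero_iff, h3] at h2
    exact congrArg Subtype.val h2
  let Q := (LinearEquiv.ofInjectiveOfFinrankEq R hR (by simp [hn])) ≪≫ₗ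
    (LinearEquiv.sumArrowLequivProdArrow (Fin s) (Fin t) K K).symm ≪≫ₗ
    LinearEquiv.funCongrLeft K K finSumFinEquiv.symm
  refine ⟨Nat.le_add_right s t, Q, fun x i => ?_⟩
  have : finSumFinEquiv.symm (Fin.castLE (Nat.le_add_right s t) i) = Sum.inl i := by
    rw [Equiv.symm_apply_eq]; rfl
  simp only [Q, LinearEquiv.trans_apply, LinearEquiv.funCongrLeft_apply, LinearMap.funLeft_apply,
    this]
  rfl

/-- Subspaces in general position are simultaneously intersections of blocks of consecutive
coordinate hyperplanes in a suitable basis. -/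
theorem exists_GL_imageSubspace_eq {n r : ℕ} (H : Fin r → Submodule K (Fin n → K))
    (hgen : ∀ y : Fin r → (Fin n → K), ∃ x, ∀ k, x - y k ∈ H k) :
    ∃ (P : GL (Fin n) K), ∀ k, ∃ c : Fin (Module.finrank K ((Fin n → K) ⧸ H k)) → Fin n,
      (∀ j j', j'.val = j.val + 1 → (c j').val = (c j).val + 1) ∧
      H k = imageSubspace P (⨅ j, coordHyperplane K (c j)) := by
  let d : Fin r → ℕ := fun k => Module.finrank K ((Fin n → K) ⧸ H k)
  let b : ∀ k, Module.Basis (Fin (d k)) K ((Fin n → K) ⧸ H k) := fun k => Module.finBasis K _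
  -- `F` stacks coordinates of all the quotients; `finSigmaFinEquiv` keeps each block consecutive.
  let F : (Fin n → K) →ₗ[K] (Fin (∑ k, d k) → K) := LinearMap.pi fun i =>
    (b (finSigmaFinEquiv.symm i).1).coord (finSigmaFinEquiv.symm i).2 ∘ₗ (H _).mkQ
  have hF : Function.Surjective F := by
    intro z
    choose y hy using fun k => (H k).mkQ_surjective
      ((b k).equivFun.symm fun j => z (finSigmaFinEquiv ⟨k, j⟩))
    obtain ⟨x, hx⟩ := hgen y
    refine ⟨x, ?_⟩
    ext i
    obtain ⟨⟨k, j⟩, rfl⟩ := finSigmaFinEquiv.surjective i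
    have h : (H k).mkQ x = (b k).equivFun.symm fun j => z (finSigmaFinEquiv ⟨k, j⟩) := by
      rw [← hy k]
      exact (Submodule.Quotient.eq (H k)).2 (hx k)
    have h' : F x (finSigmaFinEquiv ⟨k, j⟩) = (b k).coord j ((H k).mkQ x) := by
      simp only [F, LinearMap.pi_apply]
      rw [Equiv.symm_apply_apply]
      rfl
    rw [h', h, Module.Basis.coord_apply, ← Module.Basis.equivFun_apply,
      LinearEquiv.apply_symm_apply]
  obtain ⟨hs, Q, hQ⟩ := exists_linearEquiv_extending_coordinates (Module.finrank_fin_fun K) F hF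
  let P : GL (Fin n) K := Matrix.GeneralLinearGroup.toLin.symm
    (LinearMap.GeneralLinearGroup.ofLinearEquiv Q.symm)
  have hP : Matrix.mulVecLin (P : Matrix (Fin n) (Fin n) K) = Q.symm.toLinearMap := by
    have : ((Matrix.GeneralLinearGroup.toLin P : LinearMap.GeneralLinearGroup K (Fin n → K)) :
        (Fin n → K) →ₗ[K] (Fin n → K)) = Q.symm.toLinearMap := by
      rw [MulEquiv.apply_symm_apply]; rfl
    rw [← this]; rfl
  refine ⟨P, fun k => ⟨fun j => Fin.castLE hs (finSigmaFinEquiv ⟨k, j⟩), ?_, ?_⟩⟩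
  · intro j j' hj
    simp only [Fin.val_castLE, finSigmaFinEquiv_apply, hj]
    rw [add_assoc]
  · rw [imageSubspace, hP]
    ext x
    rw [Submodule.mem_map_equiv, LinearEquiv.symm_symm]
    simp only [Submodule.mem_iInf, coordHyperplane, LinearMap.mem_ker, LinearMap.proj_apply]
    have h' : ∀ j, Q x (Fin.castLE hs (finSigmaFinEquiv ⟨k, j⟩)) = (b k).repr ((H k).mkQ x) j := by
      intro j
      rw [hQ]
      simp only [F, LinearMap.pi_apply]
      rw [Equiv.symm_apply_apply]
      rfl
    simp only [h']
    rw [← Submodule.Quotient.mk_eq_zero (H k), ← Submodule.mkQ_apply,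
      ← (b k).repr.map_eq_zero_iff, Finsupp.ext_iff]
    rfl

end Coordinates

/-! ### Convergence of inverses -/

section Convergence

variable {K : Type*} [RCLike K] {n : ℕ}

/-- In a commutative matrix algebra, `B m *ᵥ u → v` implies `(B m)⁻¹ *ᵥ v → u`, provided that
every element of the algebra that maps `u` to `v` is invertible. -/
theorem tendsto_inv_mulVec (A : Subalgebra K (Matrix (Fin n) (Fin n) K))
    (hA : ∀ a ∈ A, ∀ b ∈ A, a * b = b * a) {u v : Fin n → K} (B : ℕ → GL (Fin n) K)
    (hB : ∀ m, (B m : Matrix (Fin n) (Fin n) K) ∈ A)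
    (hBinv : ∀ m, (((B m)⁻¹ : GL (Fin n) K) : Matrix (Fin n) (Fin n) K) ∈ A)
    (hu : ∀ M ∈ A, M.mulVec u = v → IsUnit M)
    (hlim : Tendsto (fun m => Matrix.mulVec (B m : Matrix (Fin n) (Fin n) K) u) atTop (𝓝 v)) :
    Tendsto (fun m => Matrix.mulVec (((B m)⁻¹ : GL (Fin n) K) : Matrix (Fin n) (Fin n) K) v)
      atTop (𝓝 u) := by
  let E : A →ₗ[K] (Fin n → K) :=
    (Matrix.mulVecBilin K K).flip u ∘ₗ A.val.toLinearMap
  obtain ⟨σ, hσ⟩ := E.rangeRestrict.exists_rightInverse_of_surjective E.range_rangeRestrict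
  -- Extending the section from the range of `E` to all of `Kⁿ` allows evaluation at `v` before `v`
  -- is known to lie in that range.
  obtain ⟨τ, hτ⟩ := σ.exists_extend
  have hsec : ∀ a : A, (τ (E a) : Matrix (Fin n) (Fin n) K).mulVec u = E a := by
    intro a
    have h1 : τ (E a) = σ ⟨E a, a, rfl⟩ := LinearMap.congr_fun hτ ⟨E a, a, rfl⟩
    have h2 := congrArg Subtype.val (LinearMap.congr_fun hσ ⟨E a, a, rfl⟩)
    rw [h1]
    exact h2
  let S : (Fin n → K) →ₗ[K] Matrix (Fin n) (Fin n) K := A.val.toLinearMap ∘ₗ τ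
  have hSA : ∀ x, S x ∈ A := fun x => (τ x).2
  have hScont : Continuous S := S.continuous_of_finiteDimensional
  let C : ℕ → Matrix (Fin n) (Fin n) K := fun m => S ((B m : Matrix _ _ K).mulVec u)
  have hCu : ∀ m, (C m).mulVec u = (B m : Matrix _ _ K).mulVec u := fun m => hsec ⟨B m, hB m⟩
  have hC : Tendsto C atTop (𝓝 (S v)) := (hScont.tendsto v).comp hlim
  have hSv : (S v).mulVec u = v := by
    have h1 : Tendsto (fun m => (C m).mulVec u) atTop (𝓝 ((S v).mulVec u)) :=
      ((continuous_id.matrix_mulVec continuous_const).tendsto (S v)).comp hC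
    simp only [hCu] at h1
    exact tendsto_nhds_unique h1 hlim
  have hdet : (S v).det ≠ 0 :=
    ((Matrix.isUnit_iff_isUnit_det _).1 (hu _ (hSA v) hSv)).ne_zero
  have hCdet : Tendsto (fun m => (C m).det) atTop (𝓝 (S v).det) :=
    ((continuous_id.matrix_det).tendsto (S v)).comp hC
  -- The adjugate is defined for every `m`, whereas `C m` is only eventually invertible.
  have hadj : Tendsto (fun m => (C m).adjugate.mulVec v) atTop (𝓝 ((S v).adjugate.mulVec v)) :=
    (((continuous_id.matrix_adjugate).matrix_mulVec continuous_const).tendsto (S v)).comp hC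
  have hmain := (hCdet.inv₀ hdet).smul hadj
  have hlimit : (S v).det⁻¹ • (S v).adjugate.mulVec v = u := by
    nth_rewrite 3 [← hSv]
    rw [Matrix.mulVec_mulVec, Matrix.adjugate_mul, Matrix.smul_mulVec, Matrix.one_mulVec,
      smul_smul, inv_mul_cancel₀ hdet, one_smul]
  rw [hlimit] at hmain
  refine hmain.congr' ?_
  filter_upwards [hCdet.eventually_ne hdet] with m hm
  -- With `v = S(v)u`: `C B⁻¹ S(v) u = B⁻¹ S(v) C u = B⁻¹ S(v) B u = S(v) u`.
  have hBv : (C m).mulVec ((((B m)⁻¹ : GL (Fin n) K) : Matrix (Fin n) (Fin n) K).mulVec v) = v := by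
    have hinv : (((B m)⁻¹ : GL (Fin n) K) : Matrix (Fin n) (Fin n) K) * (B m : Matrix _ _ K) = 1 :=
      (B m).inv_mul
    nth_rewrite 1 [← hSv]
    rw [Matrix.mulVec_mulVec, Matrix.mulVec_mulVec,
      mul_assoc, hA _ (hSA _) _ (A.mul_mem (hBinv m) (hSA v)), ← Matrix.mulVec_mulVec, hCu,
      Matrix.mulVec_mulVec, hA _ (hBinv m) _ (hSA v), mul_assoc, hinv, mul_one, hSv]
  nth_rewrite 1 [← hBv]
  rw [Matrix.mulVec_mulVec, Matrix.adjugate_mul, Matrix.smul_mulVec, Matrix.one_mulVec,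
    smul_smul, inv_mul_cancel₀ hm, one_smul]

end Convergence

open scoped IsMulCommutative in
/-- The common form of the real and the complex case: `p` constrains the degrees of the finite
extensions of `K`, hence the codimensions of the invariant subspaces. -/
theorem exists_invariantSubspaces_propertyP {K : Type} [RCLike K] {n : ℕ} (hn : 1 ≤ n)
    (G : Subgroup (GL (Fin n) K)) (hG : ∀ A ∈ G, ∀ B ∈ G, A * B = B * A) (p : ℕ → Prop)
    (hp : ∀ (F : Type) [Field F] [Algebra K F] [FiniteDimensional K F], p (Module.finrank K F)) :
    ∃ (P : GL (Fin n) K) (r : ℕ) (H : Fin r → Submodule K (Fin n → K)), 1 ≤ r ∧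
      (∀ k, IsInvariantSubspace G (H k)) ∧
      (∀ k, ∃ d, p d ∧ ∃ c : Fin d → Fin n,
        (∀ j j', j'.val = j.val + 1 → (c j').val = (c j).val + 1) ∧
        H k = imageSubspace P (⨅ j, coordHyperplane K (c j))) ∧
      PropertyP G (⋃ k, (H k : Set (Fin n → K)))ᶜ := by
  let s : Set (Matrix (Fin n) (Fin n) K) := {M | ∃ B ∈ G, (B : Matrix (Fin n) (Fin n) K) = M}
  have hs : ∀ a ∈ s, ∀ b ∈ s, a * b = b * a := by
    rintro _ ⟨B, hB, rfl⟩ _ ⟨C, hC, rfl⟩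
    exact congrArg Units.val (hG B hB C hC)
  let A := Algebra.adjoin K s
  have : IsMulCommutative A := Algebra.isMulCommutative_adjoin K hs
  have hGA : ∀ B ∈ G, (B : Matrix (Fin n) (Fin n) K) ∈ A :=
    fun B hB => Algebra.subset_adjoin ⟨B, hB, rfl⟩
  let ρ : A →ₐ[K] Module.End K (Fin n → K) :=
    (Matrix.toLinAlgEquiv' : Matrix (Fin n) (Fin n) K ≃ₐ[K] _).toAlgHom.comp A.val
  have hρ : Function.Injective ρ := Matrix.toLinAlgEquiv'.injective.comp Subtype.val_injective
  have : FiniteDimensional K A :=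
    FiniteDimensional.finiteDimensional_submodule (Subalgebra.toSubmodule A)
  have : NeZero n := ⟨by omega⟩
  have : Nontrivial A := inferInstance
  obtain ⟨r, H, hr, hinv, hdim, hgen, hunit⟩ :=
    exists_submodules_of_injective ρ hρ p (fun I hI => by
      let := Ideal.Quotient.field I
      exact hp (A ⧸ I))
  obtain ⟨P, hP⟩ := exists_GL_imageSubspace_eq H hgen
  refine ⟨P, r, H, hr, ?_, fun k => ⟨_, hdim k, hP k⟩, ?_⟩
  · intro k B hB x hx
    exact hinv k ⟨B, hGA B hB⟩ x hx
  · intro u _ v hv B hB hlim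
    refine tendsto_inv_mulVec A (fun a ha b hb => congrArg Subtype.val
      (mul_comm (⟨a, ha⟩ : A) ⟨b, hb⟩)) B (fun m => hGA _ (hB m))
      (fun m => hGA _ (G.inv_mem (hB m))) (fun M hM hMu => ?_) hlim
    by_contra hnot
    -- A non-invertible matrix is a non-unit of `A`, so `v = Mu` would fall in some `H k`.
    obtain ⟨k, hk⟩ := hunit ⟨M, hM⟩ fun h => hnot (h.map A.val)
    refine hv (Set.mem_iUnion.2 ⟨k, ?_⟩)
    rw [← hMu]
    exact hk u

theorem theorem4p1 (n : ℕ) (hn : 1 ≤ n) :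
    (∀ G : Subgroup (GL (Fin n) ℂ), (∀ A ∈ G, ∀ B ∈ G, A * B = B * A) →
      ∃ (P : GL (Fin n) ℂ) (r : ℕ) (H : Fin r → Submodule ℂ (Fin n → ℂ)),
        1 ≤ r ∧
        (∀ k, IsInvariantSubspace G (H k)) ∧
        (∀ k, ∃ i : Fin n, H k = imageSubspace P (coordHyperplane ℂ i)) ∧
        PropertyP G (⋃ k, (H k : Set (Fin n → ℂ)))ᶜ) ∧
    (∀ G : Subgroup (GL (Fin n) ℝ), (∀ A ∈ G, ∀ B ∈ G, A * B = B * A) →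
      ∃ (P : GL (Fin n) ℝ) (r : ℕ) (H : Fin r → Submodule ℝ (Fin n → ℝ)),
        1 ≤ r ∧
        (∀ k, IsInvariantSubspace G (H k)) ∧
        (∀ k, (∃ i : Fin n, H k = imageSubspace P (coordHyperplane ℝ i)) ∨
          (∃ i j : Fin n, (j : ℕ) = (i : ℕ) + 1 ∧
            H k = imageSubspace P (coordHyperplane ℝ i ⊓ coordHyperplane ℝ j))) ∧
        PropertyP G (⋃ k, (H k : Set (Fin n → ℝ)))ᶜ) := by

  refine ⟨fun G hG => ?_, fun G hG => ?_⟩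
  · obtain ⟨P, r, H, hr, hinv, hH, hprop⟩ := exists_invariantSubspaces_propertyP hn G hG
      (fun d => d = 1) fun F _ _ _ => by
        have h := IsAlgClosed.algebraMap_bijective_of_isIntegral (k := ℂ) (K := F)
        rw [← (LinearEquiv.ofBijective (Algebra.linearMap ℂ F) h).finrank_eq, Module.finrank_self]
    refine ⟨P, r, H, hr, hinv, fun k => ?_, hprop⟩
    obtain ⟨d, rfl, c, -, hc⟩ := hH k
    exact ⟨c 0, by rw [hc, iInf_unique]; rfl⟩
  · obtain ⟨P, r, H, hr, hinv, hH, hprop⟩ := exists_invariantSubspaces_propertyP hn G hG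
      (fun d => d = 1 ∨ d = 2) fun F _ _ _ => by
        rcases Real.nonempty_algEquiv_or F with ⟨⟨e⟩⟩ | ⟨⟨e⟩⟩
        · left; rw [e.toLinearEquiv.finrank_eq, Module.finrank_self]
        · right; rw [e.toLinearEquiv.finrank_eq, Complex.finrank_real_complex]
    refine ⟨P, r, H, hr, hinv, fun k => ?_, hprop⟩
    obtain ⟨d, rfl | rfl, c, hcons, hc⟩ := hH k
    · exact Or.inl ⟨c 0, by rw [hc, iInf_unique]; rfl⟩
    · refine Or.inr ⟨c 0, c 1, hcons 0 1 rfl, ?_⟩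
      rw [hc]
      congr 1
      apply le_antisymm
      · exact le_inf (iInf_le _ 0) (iInf_le _ 1)
      · refine le_iInf fun j => ?_
        fin_cases j
        · exact inf_le_left
        · exact inf_le_right
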